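/- Let $I$ be a unit square in the plane and let $\Delta$ be an equilateral triangle with a side parallel to a side of $I$; call that side of $I$ the base of $I$. A finite or countably infinite collection $\{\Delta_n\}$ of homothetic copies of $\Delta$ (homothety ratios positive or negative) can be *parallel packed* into $I$ if there are motions $\lambda_n$ of the plane, each a translation or a rotation by $180^\circ$ about some point, such that the sets $\lambda_n\Delta_n$ are contained in $I$, have pairwise disjoint interiors, and each has a side parallel to the base of $I$. Write $|\cdot|$ for area. If $\sum_n|\Delta_n|\le\frac{\sqrt3}{4}$, then $\{\Delta_n\}$ can be parallel packed into $I$. Moreover, this bound is tight: $\varrho(I,\Delta)=\frac{\sqrt3}{4}$, where $\varrho(I,\Delta)$ is the greatest real number $\varrho$ such that every finite or countably infinite collection of homothetic copies of $\Delta$ with total area at most $\varrho\cdot|I|$ can be parallel packed into $I$. -/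

import Mathlib

open scoped ENNReal

/-- The Euclidean plane. -/
abbrev EPlane : Type := EuclideanSpace ℝ (Fin 2)

/-- The closed square with vertices `A`, `A + u`, `A + u + v`, `A + v`
(a unit square when `u`, `v` are orthonormal). -/
def squareAt (A u v : EPlane) : Set EPlane :=
  {p | ∃ s ∈ Set.Icc (0 : ℝ) 1, ∃ t ∈ Set.Icc (0 : ℝ) 1, p = A + s • u + t • v}

/-- The closed triangle with vertices `P`, `Q`, `R`. -/
def triangleOf (P Q R : EPlane) : Set EPlane := convexHull ℝ {P, Q, R}

/-- `S` is a homothetic copy of `C`: the image of `C` under a homothety of ratio `r ≠ 0`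
(positive or negative) followed by a translation. -/
def IsHomotheticCopy (C S : Set EPlane) : Prop :=
  ∃ r : ℝ, r ≠ 0 ∧ ∃ w : EPlane, S = (fun x => r • x + w) '' C

/-- A convex polygon `S` has a side parallel to the direction `d`. The sides of a convex polygon
are its non-degenerate exposed segments. -/
def HasSideParallelTo (S : Set EPlane) (d : EPlane) : Prop :=
  ∃ x y : EPlane, x ≠ y ∧ IsExposed ℝ S (segment ℝ x y) ∧ ∃ k : ℝ, y - x = k • d

/-- The motions allowed in a packing: translations, and rotations by 180 degrees about a point
(equivalently, the point reflections `x ↦ w - x`). -/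
def IsPackingMotion (g : EPlane → EPlane) : Prop :=
  (∃ w : EPlane, g = fun x => x + w) ∨ (∃ w : EPlane, g = fun x => w - x)

/-- The family `S` can be parallel packed into `D`, the base of `D` having direction `d`: after
suitable motions the sets lie in `D`, have pairwise disjoint interiors, and each of them has a
side parallel to the base. -/
def CanBeParallelPacked (D : Set EPlane) (d : EPlane) {ι : Type} (S : ι → Set EPlane) : Prop :=
  ∃ g : ι → EPlane → EPlane,
    (∀ i, IsPackingMotion (g i)) ∧
    (∀ i, g i '' S i ⊆ D) ∧
    (∀ i j, i ≠ j → Disjoint (interior (g i '' S i)) (interior (g j '' S j))) ∧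
    (∀ i, HasSideParallelTo (g i '' S i) d)

/-- Every finite or countably infinite family of homothetic copies of `C` whose total area is at
most `m` can be parallel packed into `D` (with base direction `d`). -/
def AllCopiesPack (D : Set EPlane) (d : EPlane) (C : Set EPlane) (m : ℝ≥0∞) : Prop :=
  ∀ (ι : Type) [Countable ι] (S : ι → Set EPlane),
    (∀ i, IsHomotheticCopy C (S i)) →
    ∑' i, MeasureTheory.volume (S i) ≤ m →
    CanBeParallelPacked D d S

/-- `ρ` is the parallel packing constant of `D` and `C`: the greatest real number such that every
family of homothetic copies of `C` of total area at most `ρ` times the area of `D` can be parallel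
packed into `D`. -/
def IsParallelPackingConstant (D : Set EPlane) (d : EPlane) (C : Set EPlane) (ρ : ℝ) : Prop :=
  IsGreatest {c : ℝ | AllCopiesPack D d C (ENNReal.ofReal c * MeasureTheory.volume D)} ρ

/-! An equilateral triangle of side `t` has area `√3 / 4 * t ^ 2`, so the hypothesis says that the
squared sides sum to at most `1`. Stretching the vertical axis by `H = 2 / √3` turns the square into
a `1 × H` rectangle in which a triangle of side `t` has height `t`.

The triangles are placed greedily, largest first. The largest goes into the bottom left corner. The
others go into the trapezoid to the right of the line through its right side, or of the parallel
through the top left corner if that lies further right; its width at depth `Z` is `w - Z / 2`. It is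
filled from the top by horizontal layers of alternately oriented triangles, each layer as high as
its first triangle.

Suppose a triangle of side `s` no longer fits into the layer at depth `D` with first side `l`. The
triangles after the first have used more than `w - D / 2 - l - s / 2` of the width. Each uses half
its side, and that side is at least `s`, so their squares together with `s ^ 2` sum to at least `2 *
s * (w - D / 2 - l)`: the triangle opening the next layer pays for the gap left behind. Summed over
the layers this gives `layerBound`. If a new layer were too deep for the rectangle or too wide for
the trapezoid, the bound would exceed `1` (`one_lt_layerBound`); hence the greedy process never
stops (`LayerState.step`, `exists_tri_packing`).

For tightness, a single triangle of area above `√3 / 4` has a horizontal side longer than `1`, and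
the allowed motions keep it horizontal. -/

/-! ### Packing in layers -/

/-- The closed equilateral triangle of side `t` in sheared coordinates, where the second coordinate
is the depth in units for which a triangle of side `t` has height `t`. If `o` is true, it has its
horizontal side on top and top left vertex `(x, z)`; otherwise it has top vertex `(x, z)`. -/
def closedTri (o : Bool) (x z t : ℝ) : Set (ℝ × ℝ) :=
  if o then {p | z ≤ p.2 ∧ x + (p.2 - z) / 2 ≤ p.1 ∧ p.1 ≤ x + t - (p.2 - z) / 2}
  else {p | p.2 ≤ z + t ∧ x - (p.2 - z) / 2 ≤ p.1 ∧ p.1 ≤ x + (p.2 - z) / 2}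

/-- The open triangle corresponding to `closedTri`. -/
def openTri (o : Bool) (x z t : ℝ) : Set (ℝ × ℝ) :=
  if o then {p | z < p.2 ∧ x + (p.2 - z) / 2 < p.1 ∧ p.1 < x + t - (p.2 - z) / 2}
  else {p | p.2 < z + t ∧ x - (p.2 - z) / 2 < p.1 ∧ p.1 < x + (p.2 - z) / 2}

/-- The free region while a layer starting at depth `D`, with first triangle of side `l`, is being
filled: `V` is the remaining capacity of the layer, `h` the side of the last triangle, and `o` the
orientation of the next one. -/
def freeRegion (H w D l V h : ℝ) (o : Bool) : Set (ℝ × ℝ) :=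
  {p | p.1 ≤ 1 ∧ p.2 ≤ H ∧ ((D + l ≤ p.2 ∧ 1 - w + p.2 / 2 ≤ p.1) ∨
    (D ≤ p.2 ∧ p.2 ≤ D + h ∧
      if o then 1 - V - h / 2 + (p.2 - D) / 2 ≤ p.1 else 1 - V - (p.2 - D) / 2 ≤ p.1))}

/-- A triangle fitting into the remaining capacity can be put into the current layer. -/
theorem exists_place_in_layer {H w D l V h t : ℝ} (o : Bool) (hth : t ≤ h)
    (hhl : h ≤ l) (hDl : D + l ≤ H) (hV : t / 2 ≤ V) :
    ∃ x z : ℝ, closedTri o x z t ⊆ freeRegion H w D l V h o ∧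
      freeRegion H w D l (V - t / 2) t (!o) ⊆ freeRegion H w D l V h o ∧
      Disjoint (openTri o x z t) (freeRegion H w D l (V - t / 2) t (!o)) := by
  -- The triangle is pushed against the slanted left boundary of the free part of the layer, with
  -- its top at depth `D`.
  refine ⟨if o then 1 - V - h / 2 else 1 - V, D, ?_, ?_, ?_⟩
  · rintro ⟨X, Z⟩ hp
    cases o <;> simp only [closedTri, freeRegion, Set.mem_ofPred_eq, if_true, if_false,
      Bool.false_eq_true] at hp ⊢ <;> obtain ⟨h1, h2, h3⟩ := hp
    · exact ⟨by linarith, by linarith, Or.inr ⟨by linarith, by linarith, by linarith⟩⟩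
    · exact ⟨by linarith, by linarith, Or.inr ⟨by linarith, by linarith, by linarith⟩⟩
  · rintro ⟨X, Z⟩ hp
    cases o <;> simp only [freeRegion, Set.mem_ofPred_eq, if_true, if_false,
      Bool.false_eq_true, Bool.not_true, Bool.not_false] at hp ⊢ <;>
      obtain ⟨h1, h2, h3 | ⟨h3, h4, h5⟩⟩ := hp
    · exact ⟨h1, h2, Or.inl h3⟩
    · exact ⟨h1, h2, Or.inr ⟨by linarith, by linarith, by linarith⟩⟩
    · exact ⟨h1, h2, Or.inl h3⟩
    · exact ⟨h1, h2, Or.inr ⟨by linarith, by linarith, by linarith⟩⟩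
  · rw [Set.disjoint_left]
    rintro ⟨X, Z⟩ hp hq
    cases o <;> simp only [openTri, freeRegion, Set.mem_ofPred_eq, if_true, if_false,
      Bool.false_eq_true, Bool.not_true, Bool.not_false] at hp hq <;>
      obtain ⟨h1, h2, h3 | ⟨h3, h4, h5⟩⟩ := hq <;> linarith [hp.1, hp.2.1, hp.2.2]

/-- A new layer can be opened below the current one. -/
theorem freeRegion_new_layer_subset {H w D l V h t : ℝ} (o : Bool) (ht : 0 ≤ t) :
    freeRegion H w (D + l) t (w - (D + l) / 2 - t / 2) t true ⊆ freeRegion H w D l V h o := by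
  rintro ⟨X, Z⟩ hp
  simp only [freeRegion, Set.mem_ofPred_eq, if_true] at hp ⊢
  obtain ⟨h1, h2, h3 | ⟨h3, h4, h5⟩⟩ := hp
  · exact ⟨h1, h2, Or.inl ⟨by linarith, by linarith⟩⟩
  · exact ⟨h1, h2, Or.inl ⟨by linarith, by linarith⟩⟩

/-! ### The area estimate and the greedy invariant -/

/-- The lower bound for the sum of squared sides when the first triangles of the layers have sides
`t, y, …` of sum `σ`, and the first triangle of all has side `l`. -/
noncomputable def layerBound (l t w σ y : ℝ) : ℝ :=
  l ^ 2 + 3 / 2 * t ^ 2 + 2 * w * (σ - t) - σ ^ 2 / 2 + 3 / 2 * y ^ 2 - y * σ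

/-- The bound is quadratic in each variable. Minimising over `y` leaves a concave function of `σ`,
so only the ends `4 / 3 * w` and `H` matter; what remains is a numerical estimate in `t` and `l` or
`w`. The two alternatives for `σ` are the two ways a new layer can fail to fit. -/
theorem one_lt_layerBound {H l t w σ : ℝ} (y : ℝ) (hH : 0 < H) (hH2 : H ^ 2 = 4 / 3) (ht : 0 ≤ t)
    (htl : t ≤ l) (hl : l ≤ 1) (hw : w = 1 + H / 2 - max l (H / 2)) (hσ : σ ≤ H)
    (hσw : σ = H ∨ 4 / 3 * w ≤ σ) : 1 < layerBound l t w σ y := by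
  have hH1 : 1.1547 < H := by nlinarith
  have hH3 : H < 1.15471 := by nlinarith
  -- The minimum over `y` is attained at `y = σ / 3`.
  have h1 : l ^ 2 + 3 / 2 * t ^ 2 + 2 * w * (σ - t) - 2 / 3 * σ ^ 2 ≤ layerBound l t w σ y := by
    unfold layerBound; nlinarith [sq_nonneg (3 * y - σ)]
  refine lt_of_lt_of_le ?_ h1
  rcases le_total l (H / 2) with h | h
  · rw [max_eq_right h] at hw
    have hw1 : w = 1 := by linarith
    subst hw1
    -- With `w = 1` the other alternative would give `σ ≥ 4 / 3 > H`.
    have hσ : σ = H := by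
      rcases hσw with h | h
      · exact h
      · linarith
    subst hσ
    -- Under `t ≤ l`, the expression `l ^ 2 + 3 / 2 * t ^ 2 - 2 * t` is least at `t = l = 2 / 5`.
    nlinarith [sq_nonneg (l - 2 / 5), mul_nonneg (sub_nonneg.2 htl) (sub_nonneg.2 h)]
  · rw [max_eq_left h] at hw
    have hlw : l = 1 + H / 2 - w := by linarith
    have hw0 : 0 < w := by linarith
    have hw1 : w ≤ 1 := by linarith
    -- The minimum over `t` is attained at `t = 2 * w / 3`.
    have h2 : 0 ≤ 3 / 2 * t ^ 2 - 2 * w * t + 2 / 3 * w ^ 2 := by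
      have := sq_nonneg (3 * t - 2 * w)
      linarith
    have hwH := mul_nonneg hw0.le (sub_nonneg.2 hH1.le)
    have hwH' := mul_nonneg hw0.le (sub_nonneg.2 hH3.le)
    have hl2 : l ^ 2 = 4 / 3 + H - (2 + H) * w + w ^ 2 := by
      rw [hlw]; linear_combination hH2 / 4
    have e1 : 1 < l ^ 2 - 2 / 3 * w ^ 2 + 2 * w * H - 2 / 3 * H ^ 2 := by
      have := sq_nonneg (w - 1)
      rw [hl2, hH2]; linarith
    rcases hσw with h3 | h3
    · subst h3; linarith
    · have e2 : 1 < l ^ 2 - 2 / 3 * w ^ 2 + 2 * w * (4 / 3 * w) - 2 / 3 * (4 / 3 * w) ^ 2 := by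
        -- `0.869` approximates `27 * (2 + H) / 98`, the minimiser of `4 / 3 + H - (2 + H) * w + 49
        -- / 27 * w ^ 2`.
        have := sq_nonneg (w - 0.869)
        rw [hl2]; linarith
      -- concavity in `σ`
      rcases le_total σ (3 / 2 * w) with h4 | h4
      · have := mul_nonneg (sub_nonneg.2 h3)
          (show 0 ≤ 10 / 9 * w - 2 / 3 * σ by linarith)
        linarith
      · have := mul_nonneg (sub_nonneg.2 hσ)
          (show 0 ≤ 2 / 3 * (σ + H) - 2 * w by linarith)
        linarith

/-- The state of the packing: the triangles with indices less than `n`, of sides `b`, have been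
placed and `R` is free. -/
def LayerState (H w : ℝ) (b : ℕ → ℝ) (n : ℕ) (R : Set (ℝ × ℝ)) : Prop :=
  ∃ (D l V h B : ℝ) (o : Bool), R = freeRegion H w D l V h o ∧ 0 ≤ D ∧ b n ≤ h ∧ h ≤ l ∧ 0 ≤ V ∧
    D + l ≤ H ∧ V ≤ w - D / 2 - l ∧
    B + h * (2 * (w - D / 2 - l - V)) ≤ ∑ i ∈ Finset.range n, b i ^ 2 ∧
    ((D = 0 ∧ l = b 1 ∧ B = b 0 ^ 2 + b 1 ^ 2) ∨
      ∃ y, l ≤ y ∧ layerBound (b 0) (b 1) w (D + l) y ≤ B)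

/-- Either the next triangle continues the current layer, or it opens a new one; in the second case
a lack of room would force the sum of squares above `1`. In the invariant, `B` accounts for
everything up to the first triangle of the current layer, and the term with `h` for the capacity
used since. -/
theorem LayerState.step {H w : ℝ} {b : ℕ → ℝ} {n : ℕ} {R : Set (ℝ × ℝ)} (hH : 0 < H)
    (hH2 : H ^ 2 = 4 / 3) (hb : Antitone b) (hb0 : ∀ n, 0 ≤ b n)
    (hsum : ∀ n, ∑ i ∈ Finset.range n, b i ^ 2 ≤ 1) (hw : w = 1 + H / 2 - max (b 0) (H / 2))
    (hR : LayerState H w b n R) :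
    ∃ R', LayerState H w b (n + 1) R' ∧ R' ⊆ R ∧
      ∃ (o : Bool) (x z : ℝ), closedTri o x z (b n) ⊆ R ∧ Disjoint (openTri o x z (b n)) R' := by
  obtain ⟨D, l, V, h, B, o, rfl, hD, hnh, hhl, hV, hDl, hVW, hB, hy⟩ := hR
  have hs := hb0 n
  have hs' : b (n + 1) ≤ b n := hb (Nat.le_succ n)
  have hS := hsum (n + 1)
  rw [Finset.sum_range_succ] at hS
  by_cases hc : b n / 2 ≤ V
  · obtain ⟨x, z, h1, h2, h3⟩ := exists_place_in_layer (w := w) o hnh hhl hDl hc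
    refine ⟨_, ⟨D, l, V - b n / 2, b n, B, !o, rfl, hD, hs', hnh.trans hhl, by linarith, hDl,
      by linarith, ?_, hy⟩, h2, o, x, z, h1, h3⟩
    rw [Finset.sum_range_succ]
    -- The new triangle uses capacity `b n / 2` and adds exactly `b n * (2 * (b n / 2))`; lowering
    -- the factor `h` to `b n` only weakens the bound.
    nlinarith [mul_nonneg (sub_nonneg.2 hnh) (sub_nonneg.2 hVW)]
  · push Not at hc
    have hl1 : b 0 ≤ 1 := by
      have := hsum 1
      simp only [Finset.range_one, Finset.sum_singleton] at this
      nlinarith [hb0 0]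
    -- Since `V < b n / 2`, the square of the rejected triangle covers the unused capacity.
    have hA : B + 2 * b n * (w - D / 2 - l) ≤ 1 := by
      nlinarith [mul_nonneg (sub_nonneg.2 hnh) (sub_nonneg.2 hVW)]
    -- Here `y` is the height of the second layer, fixed when that layer opens and kept afterwards.
    -- The recursion is exact for the second layer; later ones lose `s ^ 2 / 2 + s * (y - l)`.
    -- Heights `s < b n` are allowed so that an overhanging layer can be cut off at the bottom.
    have key : ∀ s, 0 ≤ s → s ≤ b n → ∃ y, s ≤ y ∧
        layerBound (b 0) (b 1) w (D + l + s) y ≤ B + 2 * s * (w - D / 2 - l) := by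
      intro s hs0 hsn
      rcases hy with ⟨rfl, rfl, rfl⟩ | ⟨y, hly, hy⟩
      · exact ⟨s, le_rfl, by unfold layerBound; nlinarith⟩
      · refine ⟨y, by linarith, ?_⟩
        unfold layerBound at hy ⊢
        nlinarith [mul_nonneg hs0 (sub_nonneg.2 hly), sq_nonneg s]
    have hWl : 0 ≤ w - D / 2 - l := hV.trans hVW
    -- Otherwise the new layer, truncated to end exactly at depth `H`, already gives a bound above
    -- `1`.
    have fitH : D + l + b n ≤ H := by
      by_contra! hlt
      obtain ⟨y, -, hy'⟩ := key (H - (D + l)) (by linarith) (by linarith)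
      have := one_lt_layerBound (σ := D + l + (H - (D + l))) y hH hH2 (hb0 1)
        (hb (Nat.zero_le 1)) hl1 hw (by linarith) (Or.inl (by ring))
      nlinarith
    -- If this fails, then `2 * w < D + l + 2 * b n`; together with `b n ≤ l` it gives `D + l + b n
    -- > 4 / 3 * w`.
    have fitW : b n ≤ w - (D + l) / 2 := by
      by_contra! hlt
      obtain ⟨y, -, hy'⟩ := key (b n) hs le_rfl
      have := one_lt_layerBound (σ := D + l + b n) y hH hH2 (hb0 1)
        (hb (Nat.zero_le 1)) hl1 hw (by linarith) (Or.inr (by linarith))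
      linarith
    have hsub := freeRegion_new_layer_subset (H := H) (w := w) (D := D) (l := l) (V := V) (h := h)
      o hs
    obtain ⟨x, z, h1, h2, h3⟩ := exists_place_in_layer (H := H) (w := w) (D := D + l) (l := b n)
      (V := w - (D + l) / 2 - b n / 2) true le_rfl le_rfl fitH (by linarith)
    obtain ⟨y, hly, hy'⟩ := key (b n) hs le_rfl
    refine ⟨_, ⟨D + l, b n, _, b n, B + 2 * b n * (w - D / 2 - l), _, rfl, by linarith, hs', le_rfl,
      by linarith, fitH, by linarith, ?_, Or.inr ⟨y, hly, hy'⟩⟩, h2.trans hsub, true, x, z,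
      h1.trans hsub, h3⟩
    rw [Finset.sum_range_succ]
    nlinarith [mul_nonneg (sub_nonneg.2 hnh) (sub_nonneg.2 hVW)]

/-- Triangles of nonincreasing sides with squares of sum at most `1` can be packed into the
rectangle `[0, 1] × [0, H]`, which corresponds to the unit square. -/
theorem exists_tri_packing {H : ℝ} {b : ℕ → ℝ} (hH : 0 < H)
    (hH2 : H ^ 2 = 4 / 3) (hb : Antitone b) (hb0 : ∀ n, 0 ≤ b n)
    (hsum : ∀ n, ∑ i ∈ Finset.range n, b i ^ 2 ≤ 1) :
    ∃ (o : ℕ → Bool) (x z : ℕ → ℝ),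
      (∀ n, closedTri (o n) (x n) (z n) (b n) ⊆ Set.Icc 0 1 ×ˢ Set.Icc 0 H) ∧
      ∀ m n, m < n → Disjoint (openTri (o m) (x m) (z m) (b m))
        (closedTri (o n) (x n) (z n) (b n)) := by
  have hH1 : 1.1547 < H := by nlinarith
  have hH3 : H < 1.15471 := by nlinarith
  obtain ⟨w, hw⟩ : ∃ w, w = 1 + H / 2 - max (b 0) (H / 2) := ⟨_, rfl⟩
  have hl1 : b 0 ≤ 1 := by
    have := hsum 1
    simp only [Finset.range_one, Finset.sum_singleton] at this
    nlinarith [hb0 0]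
  have h10 : b 1 ≤ b 0 := hb (Nat.zero_le 1)
  have h21 : b 2 ≤ b 1 := hb (Nat.le_succ 1)
  have h01 : b 0 ^ 2 + b 1 ^ 2 ≤ 1 := by
    have := hsum 2
    simpa [Finset.sum_range_succ] using this
  have hw1 : w ≤ 1 := by linarith [le_max_right (b 0) (H / 2)]
  have hw0 : w ≤ 1 + H / 2 - b 0 := by linarith [le_max_left (b 0) (H / 2)]
  -- For `b 0 ≥ H / 2` this reads `b 0 + b 1 ≤ 1 + H / 2`, which holds because the sum is at most
  -- `√2`.
  have h1w : b 1 ≤ w := by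
    rcases le_total (b 0) (H / 2) with h | h
    · rw [hw, max_eq_right h]; linarith
    · rw [hw, max_eq_left h]; nlinarith [sq_nonneg (b 0 - b 1)]
  -- The stages of the free region: the whole rectangle, the trapezoid beside the largest triangle,
  -- then the layers.
  let P : ℕ → Set (ℝ × ℝ) → Prop := fun n R =>
    (n = 0 ∧ R = Set.Icc 0 1 ×ˢ Set.Icc 0 H) ∨
    (n = 1 ∧ R = {p | p.1 ≤ 1 ∧ 0 ≤ p.2 ∧ p.2 ≤ H ∧ 1 - w + p.2 / 2 ≤ p.1}) ∨
    LayerState H w b n R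
  have step : ∀ (n : ℕ) (R : {R // P n R}), ∃ R' : {R // P (n + 1) R}, R'.1 ⊆ R.1 ∧
      ∃ (o : Bool) (x z : ℝ), closedTri o x z (b n) ⊆ R.1 ∧
        Disjoint (openTri o x z (b n)) R'.1 := by
    rintro n ⟨R, ⟨rfl, rfl⟩ | ⟨rfl, rfl⟩ | hR⟩
    · refine ⟨⟨_, Or.inr (Or.inl ⟨rfl, rfl⟩)⟩, ?_, false, b 0 / 2, H - b 0, ?_, ?_⟩
      · rintro ⟨X, Z⟩ ⟨h1, h2, h3, h4⟩
        exact ⟨⟨by dsimp only at *; linarith, h1⟩, h2, h3⟩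
      · rintro ⟨X, Z⟩ hp
        simp only [closedTri, Bool.false_eq_true, if_false, Set.mem_ofPred_eq] at hp
        obtain ⟨h1, h2, h3⟩ := hp
        exact ⟨⟨by dsimp only; linarith, by dsimp only; linarith⟩, by dsimp only; linarith,
          by dsimp only; linarith⟩
      · rw [Set.disjoint_left]
        rintro ⟨X, Z⟩ hp ⟨h1, h2, h3, h4⟩
        simp only [openTri, Bool.false_eq_true, if_false, Set.mem_ofPred_eq] at hp h4
        linarith [hp.1, hp.2.1, hp.2.2]
    · have hsub : freeRegion H w 0 (b 1) (w - b 1 / 2) (b 1) true ⊆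
          {p : ℝ × ℝ | p.1 ≤ 1 ∧ 0 ≤ p.2 ∧ p.2 ≤ H ∧ 1 - w + p.2 / 2 ≤ p.1} := by
        rintro ⟨X, Z⟩ hp
        simp only [freeRegion, Set.mem_ofPred_eq, if_true] at hp ⊢
        obtain ⟨h1, h2, h3 | ⟨h3, h4, h5⟩⟩ := hp
        · exact ⟨h1, by linarith [hb0 1], h2, h3.2⟩
        · exact ⟨h1, h3, h2, by linarith⟩
      obtain ⟨x, z, h1, h2, h3⟩ := exists_place_in_layer (H := H) (w := w) (D := 0) (l := b 1)
        (V := w - b 1 / 2) true le_rfl le_rfl (by linarith) (by linarith)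
      refine ⟨⟨_, Or.inr (Or.inr ⟨0, b 1, _, b 1, _, _, rfl, le_rfl, h21, le_rfl, by linarith,
        by linarith, by linarith, ?_, Or.inl ⟨rfl, rfl, rfl⟩⟩)⟩, h2.trans hsub, true, x, z,
        h1.trans hsub, h3⟩
      simp only [Finset.sum_range_succ, Finset.range_zero, Finset.sum_empty]
      nlinarith
    · obtain ⟨R', h1, h2, h3⟩ := hR.step hH hH2 hb hb0 hsum hw
      exact ⟨⟨R', Or.inr (Or.inr h1)⟩, h2, h3⟩
  choose next hnext o x z hcl hop using step
  -- The free regions decrease, and triangle `m` is disjoint from region `m + 1`, hence from all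
  -- later triangles.
  let F : ∀ n, {R // P n R} := fun n =>
    Nat.rec (motive := fun n => {R // P n R}) ⟨_, Or.inl ⟨rfl, rfl⟩⟩ (fun n R => next n R) n
  have hF : ∀ n, F (n + 1) = next n (F n) := fun n => rfl
  have hanti : Antitone fun n => (F n).1 := antitone_nat_of_succ_le fun n => hnext n (F n)
  refine ⟨fun n => o n (F n), fun n => x n (F n), fun n => z n (F n), fun n => ?_,
    fun m n hmn => ?_⟩
  · exact (hcl n (F n)).trans (hanti (Nat.zero_le n))
  · exact (hop m (F m)).mono_right ((hcl n (F n)).trans (hanti (Nat.succ_le_of_lt hmn)))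

/-! ### Coordinates in the plane -/

theorem exists_orthonormalBasis_pair {u v : EPlane} (hu : ‖u‖ = 1) (hv : ‖v‖ = 1) (huv : inner ℝ u v = 0) :
    ∃ e : OrthonormalBasis (Fin 2) ℝ EPlane, e 0 = u ∧ e 1 = v := by
  have hvu : inner ℝ v u = 0 := by rw [real_inner_comm]; exact huv
  have ho : Orthonormal ℝ ![u, v] := by
    refine ⟨fun i => by fin_cases i <;> simpa, fun i j hij => ?_⟩
    fin_cases i <;> fin_cases j <;> first | exact absurd rfl hij | simpa
  have hc : Fintype.card (Fin 2) = Module.finrank ℝ EPlane := by simp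
  have hb := coe_basisOfOrthonormalOfCardEqFinrank ho hc
  refine ⟨(basisOfOrthonormalOfCardEqFinrank ho hc).toOrthonormalBasis (by rwa [hb]), ?_, ?_⟩ <;>
    simp [hb]

theorem eq_inner_smul_add {u v : EPlane} (hu : ‖u‖ = 1) (hv : ‖v‖ = 1) (huv : inner ℝ u v = 0)
    (p : EPlane) : p = inner ℝ u p • u + inner ℝ v p • v := by
  obtain ⟨e, rfl, rfl⟩ := exists_orthonormalBasis_pair hu hv huv
  simpa using (e.sum_repr' p).symm

theorem measurePreserving_inner_prod {u v : EPlane} (hu : ‖u‖ = 1) (hv : ‖v‖ = 1) (huv : inner ℝ u v = 0)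
    (A : EPlane) :
    MeasureTheory.MeasurePreserving fun p : EPlane => (inner ℝ u (p - A), inner ℝ v (p - A)) := by
  obtain ⟨e, rfl, rfl⟩ := exists_orthonormalBasis_pair hu hv huv
  have h1 := (MeasureTheory.volume_preserving_finTwoArrow ℝ).comp
    ((PiLp.volume_preserving_ofLp (Fin 2)).comp e.measurePreserving_repr)
  have h2 := h1.comp (MeasureTheory.measurePreserving_sub_right MeasureTheory.volume A)
  have he : (fun p : EPlane => (inner ℝ (e 0) (p - A), inner ℝ (e 1) (p - A))) =
      (MeasurableEquiv.finTwoArrow ∘ WithLp.ofLp ∘ e.repr) ∘ fun x => x - A := by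
    funext p
    simp only [Function.comp_apply, ← OrthonormalBasis.repr_apply_apply]
    rfl
  rw [he]
  exact h2

theorem mem_squareAt_iff {u v : EPlane} (hu : ‖u‖ = 1) (hv : ‖v‖ = 1) (huv : inner ℝ u v = 0)
    {A p : EPlane} :
    p ∈ squareAt A u v ↔
      inner ℝ u (p - A) ∈ Set.Icc (0 : ℝ) 1 ∧ inner ℝ v (p - A) ∈ Set.Icc (0 : ℝ) 1 := by
  have hvu : inner ℝ v u = 0 := by rw [real_inner_comm]; exact huv
  constructor
  · rintro ⟨s, hs, t, ht, rfl⟩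
    have : A + s • u + t • v - A = s • u + t • v := by abel
    rw [this]
    simp only [inner_add_right, inner_smul_right, huv, hvu, real_inner_self_eq_norm_sq, hu, hv]
    norm_num
    exact ⟨hs, ht⟩
  · rintro ⟨h1, h2⟩
    refine ⟨_, h1, _, h2, ?_⟩
    have := eq_inner_smul_add hu hv huv (p - A)
    rw [add_assoc, ← this]; abel

theorem volume_squareAt {u v : EPlane} (hu : ‖u‖ = 1) (hv : ‖v‖ = 1) (huv : inner ℝ u v = 0)
    (A : EPlane) : MeasureTheory.volume (squareAt A u v) = 1 := by
  have h := measurePreserving_inner_prod hu hv huv A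
  have he : squareAt A u v = (fun p : EPlane => (inner ℝ u (p - A), inner ℝ v (p - A))) ⁻¹'
      (Set.Icc (0 : ℝ) 1 ×ˢ Set.Icc (0 : ℝ) 1) := by
    ext p; exact mem_squareAt_iff hu hv huv
  rw [he, h.measure_preimage (measurableSet_Icc.prod measurableSet_Icc).nullMeasurableSet,
    MeasureTheory.Measure.volume_eq_prod, MeasureTheory.Measure.prod_prod]
  simp

/-! ### Triangles -/

theorem mem_triangleOf_iff {P Q R p : EPlane} : p ∈ triangleOf P Q R ↔
    ∃ a b c : ℝ, 0 ≤ a ∧ 0 ≤ b ∧ 0 ≤ c ∧ a + b + c = 1 ∧ a • P + b • Q + c • R = p := by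
  unfold triangleOf
  rw [convexHull_insert (Set.insert_nonempty _ _), convexHull_pair]
  constructor
  · intro h
    simp only [convexJoin, Set.mem_singleton_iff, Set.iUnion_iUnion_eq_left, Set.mem_iUnion] at h
    obtain ⟨q, ⟨b, c, hb, hc, hbc, rfl⟩, s, t, hs, ht, hst, rfl⟩ := h
    refine ⟨s, t * b, t * c, hs, by positivity, by positivity, ?_, ?_⟩
    · rw [add_assoc, ← mul_add, hbc, mul_one, hst]
    · simp only [smul_add, mul_smul, add_assoc]
  · rintro ⟨a, b, c, ha, hb, hc, h, rfl⟩
    rw [← convexHull_pair, ← convexHull_insert (Set.insert_nonempty _ _)]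
    have hconv := convex_convexHull ℝ ({P, Q, R} : Set EPlane)
    have hP : P ∈ convexHull ℝ {P, Q, R} := subset_convexHull _ _ (by simp)
    have hQ : Q ∈ convexHull ℝ {P, Q, R} := subset_convexHull _ _ (by simp)
    have hR : R ∈ convexHull ℝ {P, Q, R} := subset_convexHull _ _ (by simp)
    have := hconv.sum_mem (t := Finset.univ) (w := ![a, b, c]) (z := ![P, Q, R])
      (by intro i _; fin_cases i <;> simpa) (by simpa [Fin.sum_univ_three] using h)
      (by intro i _; fin_cases i <;> simpa)
    simpa [Fin.sum_univ_three] using this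

theorem image_triangleOf (c : ℝ) (w P Q R : EPlane) :
    (fun x => c • x + w) '' triangleOf P Q R =
      triangleOf (c • P + w) (c • Q + w) (c • R + w) := by
  have := AffineMap.image_convexHull
    (c • AffineMap.id ℝ EPlane + AffineMap.const ℝ EPlane w) {P, Q, R}
  simp only [Set.image_insert_eq, Set.image_singleton] at this
  exact this

theorem triangleOf_swap (P Q R : EPlane) : triangleOf P Q R = triangleOf Q P R := by
  unfold triangleOf; rw [Set.insert_comm]

/-- The horizontal side is exposed by the functional `-γ • v`: at barycentric weight `z` of the
third vertex its value falls by `z * γ ^ 2`. -/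
theorem hasSideParallelTo_triangleOf {u v : EPlane} (hu : ‖u‖ = 1) (hv : ‖v‖ = 1)
    (huv : inner ℝ u v = 0) {a γ : ℝ} (δ : ℝ) (ha : a ≠ 0) (hγ : γ ≠ 0) (L : EPlane) :
    HasSideParallelTo (triangleOf L (L + a • u) (L + δ • u + γ • v)) u := by
  have hvu : inner ℝ v u = 0 := by rw [real_inner_comm]; exact huv
  have hu0 : u ≠ 0 := by rintro rfl; simp at hu
  refine ⟨L, L + a • u, ?_, fun _ => ⟨innerSL ℝ (-γ • v), ?_⟩, a, by simp⟩
  · simp [ha, hu0]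
  have hval : ∀ x y z : ℝ, x + y + z = 1 → inner ℝ (-γ • v)
      (x • L + y • (L + a • u) + z • (L + δ • u + γ • v)) = inner ℝ (-γ • v) L - z * γ ^ 2 := by
    intro x y z h
    obtain rfl : x = 1 - y - z := by linarith
    simp only [inner_add_right, inner_smul_right, inner_smul_left, hvu,
      real_inner_self_eq_norm_sq, hv, RCLike.conj_to_real]
    ring
  ext p
  constructor
  · rintro ⟨x, y, hx, hy, hxy, rfl⟩
    refine ⟨mem_triangleOf_iff.2 ⟨x, y, 0, hx, hy, le_rfl, by linarith, by simp⟩, ?_⟩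
    rintro _ hq
    obtain ⟨x', y', z', hx', hy', hz', h', rfl⟩ := mem_triangleOf_iff.1 hq
    have := hval x y 0 (by linarith)
    rw [zero_smul, add_zero] at this
    rw [innerSL_apply_apply, innerSL_apply_apply, hval _ _ _ h', this]
    nlinarith [mul_nonneg hz' (sq_nonneg γ)]
  · rintro ⟨hp, hmax⟩
    obtain ⟨x, y, z, hx, hy, hz, h, rfl⟩ := mem_triangleOf_iff.1 hp
    have hL := hmax L (mem_triangleOf_iff.2 ⟨1, 0, 0, by simp⟩)
    rw [innerSL_apply_apply, innerSL_apply_apply, hval _ _ _ h] at hL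
    have hγ2 : 0 < γ ^ 2 := by positivity
    obtain rfl : z = 0 := by nlinarith
    exact ⟨x, y, hx, hy, by linarith, by simp⟩

theorem measurableSet_region_of_triangle (k c : ℝ) :
    MeasurableSet {p : ℝ × ℝ | 0 ≤ p.1 ∧ p.1 * c ≤ p.2 ∧ p.2 ≤ k - p.1 * c} :=
  (measurableSet_le measurable_const measurable_fst).inter
    ((measurableSet_le (measurable_fst.mul_const _) measurable_snd).inter
      (measurableSet_le measurable_snd ((measurable_fst.mul_const _).const_sub _)))

/-- Fubini with height as the first coordinate: the slice at height `y` is an interval of length `k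
- y * (k / β)`. -/
theorem volume_region_of_triangle {k β : ℝ} (hk : 0 < k) (hβ : 0 < β) :
    MeasureTheory.volume {p : ℝ × ℝ | 0 ≤ p.1 ∧ p.1 * (k / (2 * β)) ≤ p.2 ∧
      p.2 ≤ k - p.1 * (k / (2 * β))} = ENNReal.ofReal (k * β / 2) := by
  have hmeas := measurableSet_region_of_triangle k (k / (2 * β))
  rw [MeasureTheory.Measure.volume_eq_prod, MeasureTheory.Measure.prod_apply hmeas]
  have hslice : ∀ y : ℝ, MeasureTheory.volume (Prod.mk y ⁻¹' {p : ℝ × ℝ | 0 ≤ p.1 ∧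
      p.1 * (k / (2 * β)) ≤ p.2 ∧ p.2 ≤ k - p.1 * (k / (2 * β))}) =
      (Set.Icc 0 β).indicator (fun y => ENNReal.ofReal (k - y * (k / β))) y := by
    intro y
    have hkk : k / β = 2 * (k / (2 * β)) := by field_simp
    by_cases hy : y ∈ Set.Icc 0 β
    · rw [Set.indicator_of_mem hy, hkk]
      have : (Prod.mk y ⁻¹' {p : ℝ × ℝ | 0 ≤ p.1 ∧ p.1 * (k / (2 * β)) ≤ p.2 ∧
          p.2 ≤ k - p.1 * (k / (2 * β))}) =
          Set.Icc (y * (k / (2 * β))) (k - y * (k / (2 * β))) := by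
        ext x; simp [hy.1]
      rw [this, Real.volume_Icc]
      ring_nf
    · rw [Set.indicator_of_notMem hy]
      convert MeasureTheory.measure_empty (μ := MeasureTheory.volume)
      ext x
      simp only [Set.mem_preimage, Set.mem_ofPred_eq, Set.mem_empty_iff_false, iff_false, not_and,
        not_le]
      intro h0 h1
      have hyβ : β < y := by
        by_contra! h; exact hy ⟨h0, h⟩
      have : β * (k / β) < y * (k / β) := by gcongr
      rw [mul_div_cancel₀ _ hβ.ne'] at this
      rw [hkk] at this
      linarith
  rw [MeasureTheory.lintegral_congr hslice, MeasureTheory.lintegral_indicator measurableSet_Icc,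
    ← MeasureTheory.ofReal_integral_eq_lintegral_ofReal]
  · rw [MeasureTheory.integral_Icc_eq_integral_Ioc, ← intervalIntegral.integral_of_le hβ.le,
      intervalIntegral.integral_sub (by simp) (Continuous.intervalIntegrable (by fun_prop) _ _),
      intervalIntegral.integral_const, intervalIntegral.integral_mul_const, integral_id]
    congr 1
    simp only [smul_eq_mul]
    field_simp
    ring
  · exact ContinuousOn.integrableOn_Icc (by fun_prop)
  · refine (MeasureTheory.ae_restrict_iff' measurableSet_Icc).2 (Filter.Eventually.of_forall ?_)
    intro y hy
    have : y * (k / β) ≤ β * (k / β) := by gcongr; exact hy.2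
    rw [mul_div_cancel₀ _ hβ.ne'] at this
    simpa using this

theorem volume_triangleOf_of_pos {u v : EPlane} (hu : ‖u‖ = 1) (hv : ‖v‖ = 1)
    (huv : inner ℝ u v = 0) {k β : ℝ} (hk : 0 < k) (hβ : 0 < β) (L : EPlane) :
    MeasureTheory.volume (triangleOf L (L + k • u) (L + (k / 2) • u + β • v)) =
      ENNReal.ofReal (k * β / 2) := by
  have hvu : inner ℝ v u = 0 := by rw [real_inner_comm]; exact huv
  have h := measurePreserving_inner_prod hv hu hvu L
  rw [← volume_region_of_triangle hk hβ]
  have hmeas := measurableSet_region_of_triangle k (k / (2 * β))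
  rw [← h.measure_preimage hmeas.nullMeasurableSet]
  congr 1
  ext p
  rw [mem_triangleOf_iff]
  constructor
  · rintro ⟨a, b, c, ha, hb, hc, h1, rfl⟩
    obtain rfl : a = 1 - b - c := by linarith
    have e : (1 - b - c) • L + b • (L + k • u) + c • (L + (k / 2) • u + β • v) - L =
      (b * k + c * (k / 2)) • u + (c * β) • v := by module
    simp only [Set.mem_preimage, Set.mem_ofPred_eq, e, inner_add_right, inner_smul_right, huv, hvu,
      real_inner_self_eq_norm_sq, hu, hv]
    have e2 : c * β * (k / (2 * β)) = c * (k / 2) := by field_simp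
    have := mul_nonneg hb hk.le
    have := mul_nonneg ha hk.le
    have := mul_nonneg hc hβ.le
    norm_num
    rw [e2]
    exact ⟨by linarith, by linarith, by linarith⟩
  · rintro ⟨h1, h2, h3⟩
    have hp := eq_inner_smul_add hu hv huv (p - L)
    dsimp only at h1 h2 h3
    obtain ⟨X, hX⟩ : ∃ X, X = inner ℝ u (p - L) := ⟨_, rfl⟩
    obtain ⟨Y, hY⟩ : ∃ Y, Y = inner ℝ v (p - L) := ⟨_, rfl⟩
    rw [← hX, ← hY] at hp
    rw [← hY] at h1 h2 h3
    rw [← hX] at h2 h3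
    have e1 : Y * (k / (2 * β)) = (Y / (2 * β)) * k := by ring
    have e2 : Y / β = 2 * (Y / (2 * β)) := by field_simp
    rw [e1] at h2 h3
    have e3 : Y / (2 * β) ≤ X / k := (le_div_iff₀ hk).2 h2
    have e4 : X / k ≤ 1 - Y / (2 * β) := (div_le_iff₀ hk).2 (by linarith)
    refine ⟨1 - (X / k - Y / (2 * β)) - Y / β, X / k - Y / (2 * β), Y / β, by linarith,
      by linarith, by positivity, by ring, ?_⟩
    have e5 : (1 - (X / k - Y / (2 * β)) - Y / β) • L + (X / k - Y / (2 * β)) • (L + k • u) +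
      (Y / β) • (L + (k / 2) • u + β • v) =
      L + ((X / k - Y / (2 * β)) * k + Y / β * (k / 2)) • u + (Y / β * β) • v := by module
    have e6 : (X / k - Y / (2 * β)) * k + Y / β * (k / 2) = X := by
      rw [e2]; field_simp; ring
    rw [e5, e6, div_mul_cancel₀ _ hβ.ne', add_assoc, ← hp]
    abel

theorem volume_triangleOf {u v : EPlane} (hu : ‖u‖ = 1) (hv : ‖v‖ = 1)
    (huv : inner ℝ u v = 0) {k β : ℝ} (hk : k ≠ 0) (hβ : β ≠ 0) (L : EPlane) :
    MeasureTheory.volume (triangleOf L (L + k • u) (L + (k / 2) • u + β • v)) =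
      ENNReal.ofReal (|k| * |β| / 2) := by
  obtain ⟨u', hu', huu, hku⟩ : ∃ u' : EPlane, ‖u'‖ = 1 ∧ inner ℝ u' v = 0 ∧ |k| • u' = k • u := by
    rcases abs_choice k with h | h
    · exact ⟨u, hu, huv, by rw [h]⟩
    · exact ⟨-u, by simpa, by simpa, by rw [h]; simp⟩
  obtain ⟨v', hv', hvv, hβv⟩ : ∃ v' : EPlane, ‖v'‖ = 1 ∧ inner ℝ u' v' = 0 ∧ |β| • v' = β • v := by
    rcases abs_choice β with h | h
    · exact ⟨v, hv, huu, by rw [h]⟩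
    · exact ⟨-v, by simpa, by simpa, by rw [h]; simp⟩
  have := volume_triangleOf_of_pos hu' hv' hvv (abs_pos.2 hk) (abs_pos.2 hβ) L
  have h2 : (|k| / 2) • u' = (k / 2) • u := by
    rw [div_eq_inv_mul, mul_smul, hku, smul_smul]; congr 1; ring
  rwa [hku, hβv, h2] at this

/-- A copy of the triangle can be moved into a position with prescribed left end of its
horizontal side and prescribed orientation. -/
theorem exists_packingMotion {u v P : EPlane} {k β r σ : ℝ} (hσ : σ = 1 ∨ σ = -1) (w L : EPlane) :
    ∃ g, IsPackingMotion g ∧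
      g '' ((fun x => r • x + w) '' triangleOf P (P + k • u) (P + (k / 2) • u + β • v)) =
        triangleOf L (L + |r * k| • u) (L + (|r * k| / 2) • u + (σ * |r * β|) • v) := by
  -- The required vertical orientation decides between translation and point reflection. A
  -- horizontal reversal is harmless: the third vertex lies over the midpoint of the horizontal
  -- side, so its ends can be swapped.
  obtain ⟨ε, hε, hεβ⟩ : ∃ ε : ℝ, (ε = 1 ∨ ε = -1) ∧ ε * (r * β) = σ * |r * β| := by
    rcases hσ with rfl | rfl <;> rcases abs_choice (r * β) with h | h <;> rw [h]
    · exact ⟨1, by simp, by ring⟩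
    · exact ⟨-1, by simp, by ring⟩
    · exact ⟨-1, by simp, by ring⟩
    · exact ⟨1, by simp, by ring⟩
  have hmot : ∀ w' : EPlane, IsPackingMotion fun x => ε • x + w' := by
    intro w'
    rcases hε with rfl | rfl
    · exact Or.inl ⟨w', by simp⟩
    · exact Or.inr ⟨w', by funext x; simp [sub_eq_neg_add]⟩
  rw [image_triangleOf, ← hεβ]
  have hk : ε * (r * k) = |r * k| ∨ ε * (r * k) = -|r * k| := by
    rcases hε with rfl | rfl <;> rcases abs_choice (r * k) with h | h <;> rw [h] <;> simp
  rcases hk with h | h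
  · refine ⟨_, hmot (L - ε • (r • P + w)), ?_⟩
    rw [image_triangleOf, ← h]
    congr 1 <;> module
  · refine ⟨_, hmot (L + |r * k| • u - ε • (r • P + w)), ?_⟩
    rw [image_triangleOf, triangleOf_swap]
    have h' : |r * k| = -(ε * (r * k)) := by linarith
    rw [h']
    congr 1 <;> module

/-! ### The packing constant -/

/-- Coordinates in which the triangles with horizontal sides become `closedTri`. -/
noncomputable def planeCoords (H : ℝ) (A u v p : EPlane) : ℝ × ℝ :=
  (inner ℝ u (p - A), H * (1 - inner ℝ v (p - A)))

/-- The left end of the horizontal side of the triangle with coordinate set `closedTri o x z t`. -/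
noncomputable def baseLeft (H : ℝ) (A u v : EPlane) (o : Bool) (x z t : ℝ) : EPlane :=
  if o then A + x • u + (1 - z / H) • v else A + (x - t / 2) • u + (1 - (z + t) / H) • v

theorem triangleOf_subset_closedTri {u v : EPlane} (hu : ‖u‖ = 1) (hv : ‖v‖ = 1)
    (huv : inner ℝ u v = 0) {H t : ℝ} (hH : 0 < H) (ht : 0 ≤ t) (A : EPlane) (o : Bool) (x z : ℝ) :
    triangleOf (baseLeft H A u v o x z t) (baseLeft H A u v o x z t + t • u)
      (baseLeft H A u v o x z t + (t / 2) • u + ((if o then -1 else 1) * (t / H)) • v) ⊆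
      planeCoords H A u v ⁻¹' closedTri o x z t := by
  have hvu : inner ℝ v u = 0 := by rw [real_inner_comm]; exact huv
  have hc : ∀ X Y : ℝ, planeCoords H A u v (A + X • u + Y • v) = (X, H * (1 - Y)) := by
    intro X Y
    have : A + X • u + Y • v - A = X • u + Y • v := by abel
    simp [planeCoords, this, inner_add_right, inner_smul_right, huv, hvu, hu, hv]
  intro p hp
  obtain ⟨a, b, c, ha, hb, hc0, h1, rfl⟩ := mem_triangleOf_iff.1 hp
  obtain rfl : a = 1 - b - c := by linarith
  have hat := mul_nonneg ha ht
  have hbt := mul_nonneg hb ht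
  have hct := mul_nonneg hc0 ht
  cases o
  · simp only [baseLeft, Bool.false_eq_true, if_false]
    set B := A + (x - t / 2) • u + (1 - (z + t) / H) • v with hB
    have e : (1 - b - c) • B + b • (B + t • u) + c • (B + (t / 2) • u + (1 * (t / H)) • v) =
        A + (x - t / 2 + b * t + c * (t / 2)) • u + (1 - (z + t) / H + c * (t / H)) • v := by
      rw [hB]; module
    have e2 : H * (1 - (1 - (z + t) / H + c * (t / H))) = z + t - c * t := by field_simp; ring
    rw [Set.mem_preimage, e, hc, e2]
    simp only [closedTri, Bool.false_eq_true, if_false, Set.mem_ofPred_eq]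
    exact ⟨by linarith, by linarith, by linarith⟩
  · simp only [baseLeft, if_true]
    set B := A + x • u + (1 - z / H) • v with hB
    have e : (1 - b - c) • B + b • (B + t • u) + c • (B + (t / 2) • u + (-1 * (t / H)) • v) =
        A + (x + b * t + c * (t / 2)) • u + (1 - z / H - c * (t / H)) • v := by
      rw [hB]; module
    have e2 : H * (1 - (1 - z / H - c * (t / H))) = z + c * t := by field_simp; ring
    rw [Set.mem_preimage, e, hc, e2]
    simp only [closedTri, if_true, Set.mem_ofPred_eq]
    exact ⟨by linarith, by linarith, by linarith⟩

/-- An interior point can be moved slightly along `±u` and `±v` within `T`, which makes each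
defining inequality strict. -/
theorem interior_subset_openTri {u v : EPlane} (hu : ‖u‖ = 1) (hv : ‖v‖ = 1)
    (huv : inner ℝ u v = 0) {H t : ℝ} (hH : 0 < H) {A : EPlane} {o : Bool} {x z : ℝ}
    {T : Set EPlane} (hT : T ⊆ planeCoords H A u v ⁻¹' closedTri o x z t) :
    interior T ⊆ planeCoords H A u v ⁻¹' openTri o x z t := by
  have hvu : inner ℝ v u = 0 := by rw [real_inner_comm]; exact huv
  intro p hp
  obtain ⟨δ, hδ, hball⟩ := Metric.isOpen_iff.1 isOpen_interior p hp
  have hmem : ∀ d : EPlane, ‖d‖ = 1 → ∀ s : ℝ, |s| < δ →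
      planeCoords H A u v (p + s • d) ∈ closedTri o x z t := by
    intro d hd s hs
    refine hT (interior_subset (hball ?_))
    simpa [norm_smul, hd] using hs
  have hcu : ∀ s : ℝ, planeCoords H A u v (p + s • u) =
      ((planeCoords H A u v p).1 + s, (planeCoords H A u v p).2) := by
    intro s
    simp only [planeCoords, add_sub_right_comm, inner_add_right, inner_smul_right, hvu,
      real_inner_self_eq_norm_sq, hu]
    norm_num
  have hcv : ∀ s : ℝ, planeCoords H A u v (p + s • v) =
      ((planeCoords H A u v p).1, (planeCoords H A u v p).2 - H * s) := by
    intro s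
    simp only [planeCoords, add_sub_right_comm, inner_add_right, inner_smul_right, huv,
      real_inner_self_eq_norm_sq, hv]
    norm_num
    ring
  have hpos : |δ / 2| < δ := by rw [abs_of_pos] <;> linarith
  have hneg : |-(δ / 2)| < δ := by rwa [abs_neg]
  have h1 := hmem u hu _ hpos
  have h2 := hmem u hu _ hneg
  have h3 := hmem v hv _ hpos
  have h4 := hmem v hv _ hneg
  rw [hcu] at h1 h2
  rw [hcv] at h3 h4
  have hHδ := mul_pos hH hδ
  cases o <;> simp only [closedTri, openTri, Bool.false_eq_true, if_false, if_true,
    Set.mem_preimage, Set.mem_ofPred_eq] at h1 h2 h3 h4 ⊢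
  · exact ⟨by linarith [h4.1], by linarith [h2.2.1], by linarith [h1.2.2]⟩
  · exact ⟨by linarith [h3.1], by linarith [h2.2.1], by linarith [h1.2.2]⟩

/-! ### Enumeration by decreasing size -/

/-- A countable family of positive numbers with summable squares can be enumerated in
nonincreasing order. -/
theorem exists_antitone_enumeration {ι : Type} [Countable ι] {a : ι → ℝ} (ha : ∀ i, 0 < a i)
    (hs : Summable fun i => a i ^ 2) :
    ∃ (r : ι → ℕ) (b : ℕ → ℝ), Function.Injective r ∧ Antitone b ∧ (∀ n, 0 ≤ b n) ∧
      (∀ i, b (r i) = a i) ∧ ∀ n, ∑ m ∈ Finset.range n, b m ^ 2 ≤ ∑' i, a i ^ 2 := by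
  obtain ⟨f, hf⟩ := exists_injective_nat ι
  -- Ordered by decreasing size, with ties broken by an injection into `ℕ`. Each index has finitely
  -- many predecessors because the squares tend to `0`, so its rank is their number.
  let key : ι → ℝ ×ₗ ℕ := fun i => toLex (-(a i), f i)
  have hkey : Function.Injective key := fun i j h => hf (Prod.ext_iff.1 (toLex.injective h)).2
  have hle : ∀ {i j}, key i < key j → a j ≤ a i := by
    intro i j h
    rcases Prod.Lex.toLex_lt_toLex.1 h with h | ⟨h, -⟩
    · dsimp only at h; linarith
    · dsimp only at h; linarith
  have hfin : ∀ i, {j | key j < key i}.Finite := by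
    intro i
    have h := hs.tendsto_cofinite_zero.eventually (gt_mem_nhds (pow_pos (ha i) 2))
    refine (Filter.eventually_cofinite.1 h).subset fun j hj => ?_
    simp only [Set.mem_ofPred_eq, not_lt] at hj ⊢
    exact pow_le_pow_left₀ (ha i).le (hle hj) 2
  let r : ι → ℕ := fun i => {j | key j < key i}.ncard
  have hr : ∀ {i j}, key i < key j → r i < r j := by
    intro i j h
    refine Set.ncard_lt_ncard ⟨fun k hk => lt_trans hk h, fun hsub => ?_⟩ (hfin j)
    exact lt_irrefl (key i) (hsub h)
  have hrinj : Function.Injective r := by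
    intro i j h
    by_contra hij
    rcases lt_or_gt_of_ne (hkey.ne hij) with h' | h'
    · exact (hr h').ne h
    · exact (hr h').ne' h
  have hpred : ∀ i n, r i = n + 1 → ∃ k, r k = n ∧ a i ≤ a k := by
    intro i n hi
    have hne : {j | key j < key i}.Nonempty := by
      rw [← Set.ncard_pos (hfin i)]
      change 0 < r i
      omega
    obtain ⟨k, hk, hmax⟩ := Set.exists_max_image _ key (hfin i) hne
    refine ⟨k, ?_, hle hk⟩
    have : {j | key j < key i} = insert k {j | key j < key k} := by
      ext j
      simp only [Set.mem_ofPred_eq, Set.mem_insert_iff]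
      refine ⟨fun hj => ?_, ?_⟩
      · rcases (hmax j hj).eq_or_lt with h | h
        · exact Or.inl (hkey h)
        · exact Or.inr h
      · rintro (rfl | h)
        · exact hk
        · exact lt_trans h hk
    have hcard : r i = r k + 1 := by
      change Set.ncard _ = _
      rw [this, Set.ncard_insert_of_notMem (by simp) (hfin k)]
    omega
  -- Ranks that do not occur get side `0`, so finite families also yield an infinite sequence.
  have hext : ∀ i, Function.extend r a 0 (r i) = a i := fun i => hrinj.extend_apply a 0 i
  have hext0 : ∀ n, (¬∃ i, r i = n) → Function.extend r a 0 n = 0 := fun n h =>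
    Function.extend_apply' a (0 : ℕ → ℝ) n h
  have hnn : ∀ n, 0 ≤ Function.extend r a 0 n := by
    intro n
    by_cases h : ∃ i, r i = n
    · obtain ⟨i, rfl⟩ := h
      rw [hext]; exact (ha i).le
    · rw [hext0 n h]
  refine ⟨r, Function.extend r a 0, hrinj, antitone_nat_of_succ_le fun n => ?_, hnn, hext,
    fun n => ?_⟩
  · by_cases h : ∃ i, r i = n + 1
    · obtain ⟨i, hi⟩ := h
      obtain ⟨k, rfl, hk⟩ := hpred i n hi
      rw [← hi, hext, hext]; exact hk
    · rw [hext0 _ h]; exact hnn n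
  · have hsq : (fun m => Function.extend r a 0 m ^ 2) =
        Function.extend r (fun i => a i ^ 2) (0 : ℕ → ℝ) := by
      funext m
      by_cases h : ∃ i, r i = m
      · obtain ⟨i, rfl⟩ := h
        rw [hext, hrinj.extend_apply]
      · rw [hext0 m h, Function.extend_apply' _ _ _ h]; simp
    have hsum : HasSum (fun m => Function.extend r a 0 m ^ 2) (∑' i, a i ^ 2) := by
      rw [hsq]; exact (hasSum_extend_zero hrinj).2 hs.hasSum
    exact sum_le_hasSum _ (fun m _ => sq_nonneg _) hsum

theorem canBeParallelPacked_of_tsum_le {A u v P : EPlane} (hu : ‖u‖ = 1) (hv : ‖v‖ = 1)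
    (huv : inner ℝ u v = 0) {k β : ℝ} (hk : k ≠ 0) (hβ : |β| = √3 / 2 * |k|) {ι : Type}
    [Countable ι] {S : ι → Set EPlane}
    (hS : ∀ i, IsHomotheticCopy (triangleOf P (P + k • u) (P + (k / 2) • u + β • v)) (S i))
    (hvol : ∑' i, MeasureTheory.volume (S i) ≤ ENNReal.ofReal (√3 / 4)) :
    CanBeParallelPacked (squareAt A u v) u S := by
  choose r hr w hw using hS
  have h3 : 0 < √3 := by positivity
  have h33 : √3 ^ 2 = 3 := Real.sq_sqrt (by norm_num)
  have hβ0 : β ≠ 0 := abs_pos.1 (by rw [hβ]; have := abs_pos.2 hk; positivity)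
  have ha : ∀ i, 0 < |r i * k| := fun i => abs_pos.2 (mul_ne_zero (hr i) hk)
  have hrβ : ∀ i, |r i * β| = √3 / 2 * |r i * k| := by
    intro i; rw [abs_mul, abs_mul, hβ]; ring
  have hvolS : ∀ i, MeasureTheory.volume (S i) = ENNReal.ofReal (√3 / 4 * |r i * k| ^ 2) := by
    intro i
    have := volume_triangleOf hu hv huv (mul_ne_zero (hr i) hk) (mul_ne_zero (hr i) hβ0)
      (r i • P + w i)
    rw [hw i, image_triangleOf]
    convert this using 2
    · congr 1 <;> module
    · rw [hrβ]; ring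
  simp only [hvolS] at hvol
  have hnn : ∀ i, 0 ≤ √3 / 4 * |r i * k| ^ 2 := fun i => by positivity
  have hsm : Summable fun i => √3 / 4 * |r i * k| ^ 2 := by
    have := ENNReal.summable_toReal (ne_top_of_le_ne_top ENNReal.ofReal_ne_top hvol)
    simpa only [ENNReal.toReal_ofReal (hnn _)] using this
  rw [← ENNReal.ofReal_tsum_of_nonneg hnn hsm, ENNReal.ofReal_le_ofReal_iff (by positivity),
    tsum_mul_left] at hvol
  have hs : Summable fun i => |r i * k| ^ 2 := (summable_mul_left_iff (by positivity)).1 hsm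
  have hle : ∑' i, |r i * k| ^ 2 ≤ 1 := by
    by_contra! h
    have := mul_lt_mul_of_pos_left h (show 0 < √3 / 4 by positivity)
    linarith
  obtain ⟨n, b, hn, hb, hb0, hbn, hsum⟩ := exists_antitone_enumeration ha hs
  have hH : 0 < 2 / √3 := by positivity
  have hH2 : (2 / √3) ^ 2 = 4 / 3 := by rw [div_pow, h33]; norm_num
  obtain ⟨o, x, z, hbox, hdis⟩ := exists_tri_packing hH hH2 hb hb0 fun m => (hsum m).trans hle
  let L : ι → EPlane := fun i => baseLeft (2 / √3) A u v (o (n i)) (x (n i)) (z (n i)) (b (n i))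
  have hmot : ∀ i, ∃ g, IsPackingMotion g ∧ g '' S i =
      triangleOf (L i) (L i + |r i * k| • u) (L i + (|r i * k| / 2) • u +
        ((if o (n i) then -1 else 1) * |r i * β|) • v) := by
    intro i
    rw [hw i]
    exact exists_packingMotion (by cases o (n i) <;> simp) _ _
  choose g hg hgS using hmot
  have hsub : ∀ i, g i '' S i ⊆ planeCoords (2 / √3) A u v ⁻¹'
      closedTri (o (n i)) (x (n i)) (z (n i)) (b (n i)) := by
    intro i
    have e : |r i * β| = b (n i) / (2 / √3) := by
      rw [hrβ, hbn]; field_simp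
    rw [hgS, e, ← hbn]
    exact triangleOf_subset_closedTri hu hv huv hH (hb0 _) _ _ _ _
  have hint := fun i => interior_subset_openTri hu hv huv hH (hsub i)
  have hdisj : ∀ i j, n i < n j → Disjoint (interior (g i '' S i)) (interior (g j '' S j)) := by
    intro i j hij
    exact ((hdis _ _ hij).preimage _).mono (hint i) (interior_subset.trans (hsub j))
  refine ⟨g, hg, fun i p hp => ?_, fun i j hij => ?_, fun i => ?_⟩
  · obtain ⟨h1, h2⟩ := hbox _ (hsub i hp)
    rw [mem_squareAt_iff hu hv huv]
    simp only [planeCoords, Set.mem_Icc] at h1 h2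
    refine ⟨h1, ?_, ?_⟩
    · by_contra! h
      nlinarith
    · by_contra! h
      nlinarith
  · rcases lt_or_gt_of_ne (hn.ne hij) with h | h
    · exact hdisj i j h
    · exact (hdisj j i h).symm
  · rw [hgS]
    refine hasSideParallelTo_triangleOf hu hv huv _ (ha i).ne' (mul_ne_zero ?_ ?_) _
    · cases o (n i) <;> simp
    · exact abs_ne_zero.2 (mul_ne_zero (hr i) hβ0)

/-- A triangle with horizontal side longer than `1` cannot be packed into the unit square. -/
theorem le_of_allCopiesPack {A u v P : EPlane} (hu : ‖u‖ = 1) (hv : ‖v‖ = 1)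
    (huv : inner ℝ u v = 0) {k β : ℝ} (hk : k ≠ 0) (hβ : |β| = √3 / 2 * |k|) {c : ℝ}
    (hc : AllCopiesPack (squareAt A u v) u
      (triangleOf P (P + k • u) (P + (k / 2) • u + β • v)) (ENNReal.ofReal c)) :
    c ≤ √3 / 4 := by
  by_contra! hlt
  have h3 : 0 < √3 := by positivity
  have hk' := abs_pos.2 hk
  have hβ0 : β ≠ 0 := abs_pos.1 (by rw [hβ]; positivity)
  -- `s` is the side of the equilateral triangle of area exactly `c`.
  obtain ⟨s, hs, hsc⟩ : ∃ s : ℝ, 1 < s ∧ √3 / 4 * s ^ 2 ≤ c := by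
    refine ⟨√(c / (√3 / 4)), ?_, ?_⟩
    · rw [Real.lt_sqrt zero_le_one, one_pow, lt_div_iff₀ (by positivity), one_mul]
      exact hlt
    · rw [Real.sq_sqrt (by have := (show 0 < √3 / 4 by positivity).trans hlt; positivity)]
      field_simp
      exact le_rfl
  have hs0 : 0 < s := zero_lt_one.trans hs
  obtain ⟨q, hqk⟩ : ∃ q, q * k = s := ⟨s / k, div_mul_cancel₀ _ hk⟩
  have hq : q ≠ 0 := by
    rintro rfl; simp at hqk; linarith
  let S : Unit → Set EPlane := fun _ => (fun y => q • y + 0) ''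
    triangleOf P (P + k • u) (P + (k / 2) • u + β • v)
  have hST : S () = triangleOf (q • P) (q • P + s • u) (q • P + (s / 2) • u + (q * β) • v) := by
    change _ '' _ = _
    rw [image_triangleOf, ← hqk]
    congr 1 <;> module
  have hqβ : |q * β| = √3 / 2 * s := by
    rw [abs_mul, hβ, ← abs_of_pos hs0, ← hqk, abs_mul]; ring
  obtain ⟨g, hg, hgD, -⟩ := hc Unit S (fun _ => ⟨q, hq, 0, rfl⟩) (by
    rw [tsum_fintype, Finset.univ_unique, Finset.sum_singleton]
    change MeasureTheory.volume (S ()) ≤ _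
    rw [hST, volume_triangleOf hu hv huv hs0.ne' (mul_ne_zero hq hβ0), hqβ, abs_of_pos hs0]
    exact ENNReal.ofReal_le_ofReal (le_trans (le_of_eq (by ring)) hsc))
  have hL : q • P ∈ S () := by
    rw [hST, mem_triangleOf_iff]; exact ⟨1, 0, 0, by simp⟩
  have hR : q • P + s • u ∈ S () := by
    rw [hST, mem_triangleOf_iff]; exact ⟨0, 1, 0, by simp⟩
  have h1 := ((mem_squareAt_iff hu hv huv).1 (hgD () ⟨_, hL, rfl⟩)).1
  have h2 := ((mem_squareAt_iff hu hv huv).1 (hgD () ⟨_, hR, rfl⟩)).1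
  have hus : inner ℝ u (s • u) = s := by
    rw [inner_smul_right, real_inner_self_eq_norm_sq, hu]; ring
  rcases hg () with ⟨w, hw⟩ | ⟨w, hw⟩
  · rw [hw] at h1 h2
    have e : q • P + s • u + w - A = (q • P + w - A) + s • u := by abel
    rw [e, inner_add_right, hus] at h2
    linarith [h1.1, h2.2]
  · rw [hw] at h1 h2
    have e : w - (q • P + s • u) - A = (w - q • P - A) - s • u := by abel
    rw [e, inner_sub_right, hus] at h2
    linarith [h1.2, h2.1]

/-- Comparing the squared distances from `R` to `P` and `Q` puts `R` over the midpoint of `PQ`; the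
third equality then fixes its height. -/
theorem exists_equilateral_coords {u v P Q R : EPlane} (hu : ‖u‖ = 1) (hv : ‖v‖ = 1)
    (huv : inner ℝ u v = 0) (hPQ : P ≠ Q) (h₁ : dist P Q = dist Q R) (h₂ : dist Q R = dist R P)
    (hpar : ∃ k : ℝ, Q - P = k • u) :
    ∃ k β : ℝ, k ≠ 0 ∧ |β| = √3 / 2 * |k| ∧ Q = P + k • u ∧ R = P + (k / 2) • u + β • v := by
  obtain ⟨k, hk⟩ := hpar
  have hk0 : k ≠ 0 := by
    rintro rfl
    rw [zero_smul, sub_eq_zero] at hk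
    exact hPQ hk.symm
  have hQ : Q = P + k • u := by rw [← hk]; abel
  obtain ⟨α, hα⟩ : ∃ α, α = inner ℝ u (R - P) := ⟨_, rfl⟩
  obtain ⟨β, hβ⟩ : ∃ β, β = inner ℝ v (R - P) := ⟨_, rfl⟩
  have hRP := eq_inner_smul_add hu hv huv (R - P)
  rw [← hα, ← hβ] at hRP
  have hnorm : ∀ x y : ℝ, ‖x • u + y • v‖ ^ 2 = x ^ 2 + y ^ 2 := by
    intro x y
    rw [norm_add_sq_real, inner_smul_left, inner_smul_right, huv, norm_smul, norm_smul, hu, hv]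
    simp
  have d1 : dist P Q ^ 2 = k ^ 2 := by
    rw [dist_comm, dist_eq_norm, hk]
    simpa using hnorm k 0
  have d2 : dist R P ^ 2 = α ^ 2 + β ^ 2 := by rw [dist_eq_norm, hRP, hnorm]
  have d3 : dist Q R ^ 2 = (α - k) ^ 2 + β ^ 2 := by
    have : R - Q = (α - k) • u + β • v := by
      rw [hQ, ← sub_sub, hRP]; module
    rw [dist_comm, dist_eq_norm, this, hnorm]
  rw [h₁] at d1
  rw [← h₂] at d2
  have hαk : α = k / 2 := by
    have : k * (2 * α - k) = 0 := by linarith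
    rcases mul_eq_zero.1 this with h | h
    · exact absurd h hk0
    · linarith
  refine ⟨k, β, hk0, ?_, hQ, ?_⟩
  · rw [← abs_of_nonneg (show 0 ≤ √3 / 2 by positivity), ← abs_mul, ← sq_eq_sq_iff_abs_eq_abs,
      mul_pow, div_pow, Real.sq_sqrt (by norm_num)]
    rw [hαk] at d2
    linarith
  · rw [← hαk, add_assoc, ← hRP]; abel


theorem theorem2
    -- a unit square with vertices `A`, `A + u`, `A + u + v`, `A + v`
    (A u v : EPlane) (hu : ‖u‖ = 1) (hv : ‖v‖ = 1) (huv : inner ℝ u v = 0)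
    -- a non-degenerate equilateral triangle
    (P Q R : EPlane) (hPQ : P ≠ Q) (h₁ : dist P Q = dist Q R) (h₂ : dist Q R = dist R P)
    -- whose side `PQ` is parallel to the side of the square from `A` to `A + u` (the base)
    (hpar : ∃ k : ℝ, Q - P = k • u) :
    (∀ (ι : Type) [Countable ι] (S : ι → Set EPlane),
      (∀ i, IsHomotheticCopy (triangleOf P Q R) (S i)) →
      ∑' i, MeasureTheory.volume (S i) ≤ ENNReal.ofReal (√3 / 4) →
      CanBeParallelPacked (squareAt A u v) u S) ∧
    IsParallelPackingConstant (squareAt A u v) u (triangleOf P Q R) (√3 / 4) := by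
  obtain ⟨k, β, hk, hβ, rfl, rfl⟩ := exists_equilateral_coords hu hv huv hPQ h₁ h₂ hpar
  have hpack : ∀ (ι : Type) [Countable ι] (S : ι → Set EPlane),
      (∀ i, IsHomotheticCopy (triangleOf P (P + k • u) (P + (k / 2) • u + β • v)) (S i)) →
      ∑' i, MeasureTheory.volume (S i) ≤ ENNReal.ofReal (√3 / 4) →
      CanBeParallelPacked (squareAt A u v) u S := fun ι _ S hS hvol =>
    canBeParallelPacked_of_tsum_le hu hv huv hk hβ hS hvol
  have hD := volume_squareAt hu hv huv A
  refine ⟨hpack, ?_, fun c hc => ?_⟩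
  · rw [Set.mem_ofPred_eq, hD, mul_one]
    exact hpack
  · rw [Set.mem_ofPred_eq, hD, mul_one] at hc
    exact le_of_allCopiesPack hu hv huv hk hβ hc
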